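/- Let $m\ge 4$ and let $C_m$ be the cycle graph on the vertex set $[m]$. Let $\mathcal L$ be the space of symmetric $m\times m$ matrices $K$ with $K_{ij}=0$ whenever $i\ne j$ and $\{i,j\}$ is not an edge of $C_m$. The ML degree of $C_m$ is the number of complex symmetric matrices $\Sigma$, for a generic complex symmetric $m\times m$ matrix $S$, such that $\Sigma_{ij}=S_{ij}$ whenever $i=j$ or $\{i,j\}$ is an edge of $C_m$, and $\Sigma$ is invertible with $\Sigma^{-1}\in\mathcal L_{\mathbb C}$; here "generic" means that the number is the same for all $S$ outside the zero set of some nonzero polynomial in the entries $s_{ij}$ $(i\le j)$ of $S$. Then the ML degree of $C_m$ is well defined (there is such a finite generic number) and strictly larger than $1$. Moreover, the maximum likelihood estimate is not a rational function of the data: writing $\hat\Sigma(S)$ for the positive definite matrix whose inverse maximizes $\log\det K-\operatorname{trace}(SK)$ over all positive definite real $K\in\mathcal L$, it is not the case that for every pair $(i,j)$ there are real polynomials $p,q$ in the entries of $S$, with $q\neq 0$, such that $\hat\Sigma(S)_{ij}=p(S)/q(S)$ for all real positive definite $S$ with $q(S)\ne 0$. -/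

import Mathlib

namespace GaussianGraphical

variable {V : Type*}

/-- The linear space `L_G` of concentration matrices of the Gaussian graphical model of `G`:
symmetric matrices whose off-diagonal entries vanish at all non-edges (diagonal entries are
free, i.e. every vertex is regarded as carrying a self-loop). -/
def concentrationSpace (𝕜 : Type*) [Field 𝕜] (G : SimpleGraph V) :
    Submodule 𝕜 (Matrix V V 𝕜) where
  carrier := {K | K.IsSymm ∧ ∀ i j, i ≠ j → ¬ G.Adj i j → K i j = 0}
  add_mem' := fun {A B} hA hB =>
    ⟨hA.1.add hB.1, fun i j hij h => by simp [hA.2 i j hij h, hB.2 i j hij h]⟩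
  zero_mem' := ⟨Matrix.isSymm_zero, fun _ _ _ _ => rfl⟩
  smul_mem' := fun c {A} hA => ⟨hA.1.smul c, fun i j hij h => by simp [hA.2 i j hij h]⟩

/-- The symmetric matrix with entries `s_{ij}`. A function on `Sym2 V` is the same thing as a
symmetric matrix, and `MvPolynomial (Sym2 V) 𝕜` is the polynomial ring in its entries. -/
def symMatrix {𝕜 : Type*} (s : Sym2 V → 𝕜) : Matrix V V 𝕜 :=
  Matrix.of fun i j => s s(i, j)

variable [Fintype V] [DecidableEq V]

/-- The complex solutions `T` (in the role of the covariance matrix) of the likelihood equations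
with data `S`: `T` is symmetric, agrees with `S` on the diagonal and on the edges of `G`, and is
invertible with inverse in the complexification of `L_G`. -/
def likelihoodSolutions (G : SimpleGraph V) (S : Matrix V V ℂ) : Set (Matrix V V ℂ) :=
  {T | T.IsSymm ∧ (∀ i j, i = j ∨ G.Adj i j → T i j = S i j) ∧
    ∃ K ∈ concentrationSpace ℂ G, T * K = 1}

/-- For generic complex symmetric `S`, i.e. off the zero locus of some nonzero polynomial in the
entries of `S`, the likelihood equations have exactly `N` complex solutions. -/
def HasGenericSolutionCount (G : SimpleGraph V) (N : ℕ) : Prop :=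
  ∃ f : MvPolynomial (Sym2 V) ℂ, f ≠ 0 ∧
    ∀ s : Sym2 V → ℂ, MvPolynomial.eval s f ≠ 0 →
      (likelihoodSolutions G (symMatrix s)).encard = N

/-- The generic number of solutions is unique, since two nonempty Zariski open sets meet. -/
theorem HasGenericSolutionCount.unique {G : SimpleGraph V} {M N : ℕ}
    (hM : HasGenericSolutionCount G M) (hN : HasGenericSolutionCount G N) : M = N := by
  obtain ⟨f, hf, hfM⟩ := hM
  obtain ⟨g, hg, hgN⟩ := hN
  obtain ⟨s, hs⟩ : ∃ s, MvPolynomial.eval s (f * g) ≠ 0 := by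
    by_contra! h
    exact mul_ne_zero hf hg (MvPolynomial.funext fun s => by simpa using h s)
  rw [map_mul] at hs
  have h := (hfM s (left_ne_zero_of_mul hs)).symm.trans (hgN s (right_ne_zero_of_mul hs))
  exact_mod_cast h

open Classical in
/-- The ML degree of the Gaussian graphical model of `G`: the number of complex solutions of the
likelihood equations for generic data. (The default value `0` is used if there were no such finite
number.) -/
noncomputable def mlDegree (G : SimpleGraph V) : ℕ :=
  if h : ∃ N, HasGenericSolutionCount G N then h.choose else 0

/-- The Gaussian log-likelihood of the concentration matrix `K` given the sample covariance matrix
`S` (up to the constant factor `n / 2`). -/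
noncomputable def logLikelihood (S K : Matrix V V ℝ) : ℝ :=
  Real.log K.det - (S * K).trace

/-- `T` is a maximum likelihood estimate of the covariance matrix in the Gaussian graphical model
of `G`, given the sample covariance matrix `S`. -/
def IsMLE (G : SimpleGraph V) (S T : Matrix V V ℝ) : Prop :=
  T.PosDef ∧ T⁻¹ ∈ concentrationSpace ℝ G ∧
    ∀ K ∈ concentrationSpace ℝ G, K.PosDef → logLikelihood S K ≤ logLikelihood S T⁻¹

/-- The MLE is a rational function of the data: every entry of the MLE is given, on positive
definite sample covariance matrices `S`, by a quotient `p / q` of real polynomials in the entries of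
`S`, wherever its denominator does not vanish. -/
def MLEIsRational (G : SimpleGraph V) : Prop :=
  ∀ i j : V, ∃ p q : MvPolynomial (Sym2 V) ℝ, q ≠ 0 ∧
    ∀ (s : Sym2 V → ℝ) (T : Matrix V V ℝ), (symMatrix s).PosDef → IsMLE G (symMatrix s) T →
      MvPolynomial.eval s q ≠ 0 →
        T i j = MvPolynomial.eval s p / MvPolynomial.eval s q

end GaussianGraphical

/-! Once the non-edge coordinates are carried along, the likelihood equations describe the fibres of
a map between affine spaces of equal dimension, `dataMap`. It sends `K` to the diagonal and edge
entries of its inverse. Where that inverse is positive definite, the derivative is injective, so the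
map is open there (`map_nhds_dataMap`); hence it is dominant and, by transcendence degree,
generically finite. The generic fibre is the root set of a separable specialization of the minimal
polynomial of a primitive element, so its cardinality is well defined
(`exists_generic_fiber_encard`).

For more than one generic solution, it suffices to find special data with two solutions, one of them
positive definite (`exists_generic_two_solutions`): perturbing the other solution moves the data to
generic position, and the perturbed data stay in the open image of a neighbourhood of the first.
Such data are an explicit matrix for `m = 4`, and for `m ≥ 5` the identity, whose second solution is
a circulant matrix built from sines.

Real parameters near the identity matrix are the inverses of maximum likelihood estimates, and they
are Zariski dense among the complex parameters. A rational formula for the estimate would therefore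
hold for every complex solution over generic data (`apply_eq_div_of_isMLE_eq_div`), forcing the two
solutions to coincide. -/

section GenericFiber

/-! ### Generic fibres of generically finite dominant maps -/

open Polynomial nonZeroDivisors

variable {R A : Type*} [CommRing R] [IsDomain R] [CommRing A] [IsDomain A] [Algebra R A]

/-- A finitely generated algebraic extension of domains of characteristic zero is, up to
denominators from the base, generated by a single integral element. -/
theorem exists_isIntegral_forall_smul_eq_aeval [CharZero R] [FaithfulSMul R A]
    [Algebra.IsAlgebraic R A] [Algebra.FiniteType R A] :
    ∃ θ : A, IsIntegral R θ ∧
      ∀ a : A, ∃ e : R, e ≠ 0 ∧ ∃ G : R[X], e • a = aeval θ G := by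
  let F := FractionRing R
  let E := FractionRing A
  let _ : Algebra F E := FractionRing.liftAlgebra R E
  have : IsScalarTower R F E := FractionRing.isScalarTower_liftAlgebra R E
  have : Algebra.IsAlgebraic R E := (IsFractionRing.isAlgebraic_iff' R A E).mp inferInstance
  have : Algebra.IsAlgebraic F E := (IsFractionRing.comap_isAlgebraic_iff (A := R)).mp inferInstance
  have : Algebra.EssFiniteType A E := .of_isLocalization E A⁰
  have : Algebra.EssFiniteType R E := .comp R A E
  have : Algebra.EssFiniteType F E := .of_comp R F E
  have : FiniteDimensional F E := Algebra.finite_of_essFiniteType_of_isAlgebraic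
  have : CharZero F := charZero_of_injective_algebraMap (IsFractionRing.injective R F)
  obtain ⟨x, hx⟩ := Field.exists_primitive_element F E
  -- As `A` is algebraic over `R`, its fraction field only needs denominators from `R`. Scaling the
  -- primitive element by such denominators makes it integral.
  obtain ⟨a, ⟨_, r, hr, rfl⟩, hxa⟩ :=
    IsLocalization.exists_mk'_eq (Algebra.algebraMapSubmonoid A R⁰) x
  have hr0 : r ≠ 0 := nonZeroDivisors.ne_zero hr
  obtain ⟨y, hy0, hy⟩ := (Algebra.IsAlgebraic.isAlgebraic (R := R) a).exists_integral_multiple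
  refine ⟨y • a, hy, fun b => ?_⟩
  have hinj : Function.Injective (algebraMap R E) := FaithfulSMul.algebraMap_injective R E
  have hxθ : x = algebraMap F E (algebraMap R F (y * r))⁻¹ * algebraMap A E (y • a) := by
    have h1 : algebraMap A E a = x * algebraMap R E r := by
      rw [← hxa, IsScalarTower.algebraMap_apply R A E]
      exact (IsLocalization.mk'_spec _ _ _).symm
    have h2 : algebraMap R E y ≠ 0 := fun h => hy0 (hinj (by simpa using h))
    have h3 : algebraMap R E r ≠ 0 := fun h => hr0 (hinj (by simpa using h))
    rw [map_inv₀, ← IsScalarTower.algebraMap_apply, Algebra.smul_def, map_mul, map_mul, h1,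
      ← IsScalarTower.algebraMap_apply,
      show algebraMap R E y * (x * algebraMap R E r) =
        (algebraMap R E y * algebraMap R E r) * x by ring, inv_mul_cancel_left₀ (mul_ne_zero h2 h3)]
  have htop : IntermediateField.adjoin F {algebraMap A E (y • a)} = ⊤ := by
    rw [eq_top_iff, ← hx, IntermediateField.adjoin_simple_le_iff, hxθ]
    exact mul_mem (IntermediateField.algebraMap_mem _ _)
      (IntermediateField.mem_adjoin_simple_self _ _)
  have htop' : algebraMap A E b ∈ Algebra.adjoin F {algebraMap A E (y • a)} := by
    rw [IntermediateField.adjoin_eq_top_iff.mp htop]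
    trivial
  rw [Algebra.adjoin_singleton_eq_range_aeval] at htop'
  obtain ⟨G, hG⟩ := htop'
  obtain ⟨e, he, hGe⟩ := IsLocalization.integerNormalization_spec R⁰ G
  refine ⟨e, nonZeroDivisors.ne_zero he, IsLocalization.integerNormalization R⁰ G, ?_⟩
  apply IsFractionRing.injective A E
  rw [← aeval_algebraMap_apply, ← aeval_map_algebraMap F, hGe, ← algebraMap_smul F e G,
    map_smul (aeval _), algebraMap_smul, Algebra.smul_def, Algebra.smul_def, map_mul, ← IsScalarTower.algebraMap_apply]
  exact congrArg (algebraMap R E e * ·) hG.symm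

/-- An irreducible monic polynomial over an integrally closed domain of characteristic zero
stays separable after applying any ring homomorphism to a field that does not kill a suitable
nonzero element. -/
theorem exists_ne_zero_forall_separable_map [CharZero R] [IsIntegrallyClosed R] {p : R[X]}
    (hp : p.Monic) (hirr : Irreducible p) :
    ∃ d : R, d ≠ 0 ∧ ∀ {k : Type*} [Field k] (s : R →+* k), s d ≠ 0 → (p.map s).Separable := by
  let F := FractionRing R
  have : CharZero F := charZero_of_injective_algebraMap (IsFractionRing.injective R F)
  have hsep : (p.map (algebraMap R F)).Separable :=
    ((hp.irreducible_iff_irreducible_map_fraction_map).1 hirr).separable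
  obtain ⟨u, v, huv⟩ := hsep
  obtain ⟨e, he, hu⟩ := IsLocalization.integerNormalization_spec R⁰ u
  obtain ⟨e', he', hv⟩ := IsLocalization.integerNormalization_spec R⁰ v
  set u' := IsLocalization.integerNormalization R⁰ u
  set v' := IsLocalization.integerNormalization R⁰ v
  -- The Bézout identity over the fraction field, cleared of denominators; it survives every
  -- specialization that does not kill `e * e'`.
  have key : e' • u' * p + e • v' * derivative p = C (e * e') := by
    apply map_injective _ (IsFractionRing.injective R F)
    rw [Polynomial.map_add, Polynomial.map_mul, Polynomial.map_mul, ← derivative_map,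
      Polynomial.map_smul, Polynomial.map_smul, hu, hv, map_C, map_mul, C_mul]
    simp only [Algebra.smul_def, Polynomial.algebraMap_apply]
    linear_combination (C (algebraMap R F e) * C (algebraMap R F e')) * huv
  refine ⟨e * e', mul_ne_zero (nonZeroDivisors.ne_zero he) (nonZeroDivisors.ne_zero he'),
    fun {k} _ s hs => ?_⟩
  refine ⟨C (s (e * e'))⁻¹ * (e' • u').map s, C (s (e * e'))⁻¹ * (e • v').map s, ?_⟩
  have h := congrArg (Polynomial.map s) key
  rw [Polynomial.map_add, Polynomial.map_mul, Polynomial.map_mul, ← derivative_map, map_C] at h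
  rw [mul_assoc, mul_assoc, ← mul_add, h, ← C_mul, inv_mul_cancel₀ hs, C_1]

/-- If `A` is generated over `R` by an integral element `θ` up to powers of `f`, then the points of
`A` over a point of `R` with `f ≠ 0` are the roots of the minimal polynomial of `θ`. -/
theorem exists_ringHom_of_eval₂_minpoly_eq_zero [IsIntegrallyClosed R] [FaithfulSMul R A]
    {θ : A} (hθ : IsIntegral R θ) {f : R}
    (hf : ∀ a : A, ∃ (n : ℕ) (G : R[X]), f ^ n • a = aeval θ G) {k : Type*} [Field k]
    (s : R →+* k) (hs : s f ≠ 0) {z : k} (hz : (minpoly R θ).eval₂ s z = 0) :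
    ∃ t : A →+* k, t.comp (algebraMap R A) = s ∧ t θ = z := by
  have hvanish : ∀ g : R[X], aeval θ g = 0 → g.eval₂ s z = 0 := fun g hg => by
    obtain ⟨h, rfl⟩ := minpoly.isIntegrallyClosed_dvd hθ hg
    rw [eval₂_mul, hz, zero_mul]
  choose n G hG using hf
  -- The pair `(n a, G a)` is an arbitrary choice; `ht` shows that any other representation of `a`
  -- gives the same value, because two representations differ by a multiple of the minimal
  -- polynomial.
  let t : A → k := fun a => (G a).eval₂ s z / s f ^ n a
  have ht : ∀ (a : A) (m : ℕ) (H : R[X]), f ^ m • a = aeval θ H → t a * s f ^ m = H.eval₂ s z := by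
    intro a m H hH
    have h0 : aeval θ (C (f ^ m) * G a - C (f ^ n a) * H) = 0 := by
      rw [map_sub, map_mul, map_mul, aeval_C, aeval_C, ← Algebra.smul_def, ← Algebra.smul_def,
        ← hG, ← hH, smul_comm, sub_self]
    have h1 := hvanish _ h0
    rw [eval₂_sub, eval₂_mul, eval₂_mul, eval₂_C, eval₂_C, map_pow, map_pow] at h1
    rw [div_mul_eq_mul_div, div_eq_iff (pow_ne_zero _ hs)]
    linear_combination h1
  have hpow : ∀ m, s f ^ m ≠ 0 := fun m => pow_ne_zero m hs
  have halg : ∀ r, t (algebraMap R A r) = s r := fun r => by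
    simpa using ht (algebraMap R A r) 0 (C r) (by simp)
  refine ⟨{ toFun := t, map_one' := ?_, map_mul' := ?_, map_zero' := ?_, map_add' := ?_ }, ?_, ?_⟩
  · simpa using halg 1
  · intro a b
    have h := ht (a * b) (n a + n b) (G a * G b) (by
      rw [map_mul, ← hG, ← hG, pow_add, smul_mul_smul_comm])
    apply mul_right_cancel₀ (hpow (n a + n b))
    rw [h, eval₂_mul, ← ht a _ _ (hG a), ← ht b _ _ (hG b), pow_add]
    ring
  · simpa using halg 0
  · intro a b
    have h := ht (a + b) (n a + n b) (C (f ^ n b) * G a + C (f ^ n a) * G b) (by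
      rw [map_add, map_mul, map_mul, ← hG, ← hG, aeval_C, aeval_C, ← Algebra.smul_def,
        ← Algebra.smul_def, smul_smul, smul_smul, smul_add, pow_add, mul_comm (f ^ n b)])
    apply mul_right_cancel₀ (hpow (n a + n b))
    rw [h, eval₂_add, eval₂_mul, eval₂_mul, ← ht a _ _ (hG a), ← ht b _ _ (hG b), pow_add,
      eval₂_C, eval₂_C, map_pow, map_pow]
    ring
  · exact RingHom.ext halg
  · simpa using ht θ 0 X (by simp)

/-- The generic fibre of a generically finite dominant morphism of affine varieties over an
algebraically closed field of characteristic zero has a well-defined number of points. -/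
theorem exists_generic_fiber_encard [CharZero R] [IsIntegrallyClosed R] [FaithfulSMul R A]
    [Algebra.IsAlgebraic R A] [Algebra.FiniteType R A] (k : Type*) [Field k] [IsAlgClosed k] :
    ∃ (N : ℕ) (f : R), f ≠ 0 ∧ ∀ s : R →+* k, s f ≠ 0 →
      {t : A →+* k | t.comp (algebraMap R A) = s}.encard = N := by
  classical
  obtain ⟨θ, hθ, hgen⟩ := exists_isIntegral_forall_smul_eq_aeval (R := R) (A := A)
  obtain ⟨d, hd, hsep⟩ := exists_ne_zero_forall_separable_map (minpoly.monic hθ)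
    (minpoly.irreducible hθ)
  obtain ⟨T, hT⟩ := ‹Algebra.FiniteType R A›.out
  choose e he G hG using hgen
  -- Off the zeros of `f` the minimal polynomial stays separable, and each of the finitely many
  -- generators is determined by `θ`.
  set f := d * ∏ a ∈ T, e a with hf
  have hf0 : f ≠ 0 := mul_ne_zero hd (Finset.prod_ne_zero_iff.mpr fun a _ => he a)
  have hfgen : ∀ a ∈ T, ∃ H : R[X], f • a = aeval θ H := fun a ha => by
    obtain ⟨c, hc⟩ := (Finset.dvd_prod_of_mem e ha).mul_left d
    refine ⟨C c * G a, ?_⟩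
    rw [map_mul, aeval_C, ← hG, ← Algebra.smul_def, smul_smul, hf, hc, mul_comm]
  have hfall : ∀ a : A, ∃ (n : ℕ) (H : R[X]), f ^ n • a = aeval θ H := fun a => by
    have ha : a ∈ Algebra.adjoin R (T : Set A) := by rw [hT]; trivial
    induction ha using Algebra.adjoin_induction with
    | mem x hx =>
      obtain ⟨H, hH⟩ := hfgen x hx
      exact ⟨1, H, by rw [pow_one, hH]⟩
    | algebraMap r => exact ⟨0, C r, by simp⟩
    | add x y _ _ hx hy =>
      obtain ⟨n, H, h⟩ := hx
      obtain ⟨n', H', h'⟩ := hy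
      refine ⟨n + n', C (f ^ n') * H + C (f ^ n) * H', ?_⟩
      rw [map_add, map_mul, map_mul, ← h, ← h', aeval_C, aeval_C, ← Algebra.smul_def,
        ← Algebra.smul_def, smul_smul, smul_smul, smul_add, pow_add, mul_comm (f ^ n')]
    | mul x y _ _ hx hy =>
      obtain ⟨n, H, h⟩ := hx
      obtain ⟨n', H', h'⟩ := hy
      exact ⟨n + n', H * H', by rw [map_mul, ← h, ← h', pow_add, smul_mul_smul_comm]⟩
  refine ⟨(minpoly R θ).natDegree, f, hf0, fun s hs => ?_⟩
  have hsd : s d ≠ 0 := fun h => hs (by rw [hf, map_mul, h, zero_mul])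
  have hmon := (minpoly.monic hθ).map s
  have heval : ∀ t : A →+* k, t.comp (algebraMap R A) = s → ∀ H : R[X],
      t (aeval θ H) = H.eval₂ s (t θ) := fun t ht H => by
    rw [aeval_def, hom_eval₂, ht]
  have hbij : Set.BijOn (fun t : A →+* k => t θ) {t | t.comp (algebraMap R A) = s}
      ((minpoly R θ).map s).roots.toFinset := by
    refine ⟨fun t ht => ?_, fun t ht t' ht' htt' => ?_, fun z hz => ?_⟩
    · simp only [Finset.mem_coe, Multiset.mem_toFinset, mem_roots hmon.ne_zero, IsRoot,
        eval_map]
      rw [← heval t ht, minpoly.aeval, map_zero]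
    · have h : ∀ a ∈ (T : Set A), t a = t' a := fun a ha => by
        obtain ⟨H, hH⟩ := hfgen a ha
        have h1 := heval t ht H
        have h2 := heval t' ht' H
        have hfs : t (algebraMap R A f) = s f := RingHom.congr_fun ht f
        have hfs' : t' (algebraMap R A f) = s f := RingHom.congr_fun ht' f
        rw [← hH, Algebra.smul_def, map_mul, hfs] at h1
        rw [← hH, Algebra.smul_def, map_mul, hfs'] at h2
        apply mul_left_cancel₀ hs
        rw [h1, h2]
        exact congrArg (fun z => H.eval₂ s z) htt'
      ext a
      have ha : a ∈ Algebra.adjoin R (T : Set A) := by rw [hT]; trivial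
      induction ha using Algebra.adjoin_induction with
      | mem x hx => exact h x hx
      | algebraMap r => exact (RingHom.congr_fun ht r).trans (RingHom.congr_fun ht' r).symm
      | add x y _ _ hx hy => rw [map_add, map_add, hx, hy]
      | mul x y _ _ hx hy => rw [map_mul, map_mul, hx, hy]
    · simp only [Finset.mem_coe, Multiset.mem_toFinset, mem_roots hmon.ne_zero, IsRoot,
        eval_map] at hz
      obtain ⟨t, ht, htz⟩ := exists_ringHom_of_eval₂_minpoly_eq_zero hθ hfall s hs hz
      exact ⟨t, ht, htz⟩
  -- A separable polynomial over an algebraically closed field has as many distinct roots as its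
  -- degree.
  rw [← hbij.injOn.encard_image, hbij.image_eq, Set.encard_coe_eq_coe_finsetCard,
    Multiset.toFinset_card_of_nodup (nodup_roots (hsep s hsd)),
    IsAlgClosed.card_roots_eq_natDegree, (minpoly.monic hθ).natDegree_map]

end GenericFiber

/-! ### Likelihood equations as fibres of `dataMap` -/

namespace GaussianGraphical

open MvPolynomial

section Parametrization

variable {V : Type*} (G : SimpleGraph V)

theorem exists_symMatrix_eq {k : Type*} {M : Matrix V V k} (hM : M.IsSymm) :
    ∃ s : Sym2 V → k, symMatrix s = M :=
  ⟨Sym2.lift ⟨fun i j => M i j, fun i j => (hM.apply i j).symm⟩, rfl⟩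

theorem symMatrix_apply {k : Type*} (s : Sym2 V → k) (i j : V) : symMatrix s i j = s s(i, j) :=
  rfl

open Classical in
/-- The matrix in `L_G` whose entries on the diagonal and on the edges are given by `x`. -/
noncomputable def concMatrix {k : Type*} [Zero k] (x : Sym2 V → k) : Matrix V V k :=
  Matrix.of fun i j => if i = j ∨ G.Adj i j then x s(i, j) else 0

variable {G}

theorem concMatrix_apply_of {k : Type*} [Zero k] (x : Sym2 V → k) {i j : V}
    (h : i = j ∨ G.Adj i j) : concMatrix G x i j = x s(i, j) := if_pos h

theorem concMatrix_apply_of_not {k : Type*} [Zero k] (x : Sym2 V → k) {i j : V}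
    (h : ¬ (i = j ∨ G.Adj i j)) : concMatrix G x i j = 0 := if_neg h

theorem eq_or_adj_comm {i j : V} : (j = i ∨ G.Adj j i) ↔ (i = j ∨ G.Adj i j) := by
  rw [eq_comm, G.adj_comm]

theorem concMatrix_isSymm {k : Type*} [Zero k] (x : Sym2 V → k) : (concMatrix G x).IsSymm := by
  ext i j
  by_cases h : i = j ∨ G.Adj i j
  · rw [Matrix.transpose_apply, concMatrix_apply_of x h, concMatrix_apply_of x (eq_or_adj_comm.2 h),
      Sym2.eq_swap]
  · rw [Matrix.transpose_apply, concMatrix_apply_of_not x h,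
      concMatrix_apply_of_not x (mt eq_or_adj_comm.1 h)]

theorem concMatrix_mem {k : Type*} [Field k] (x : Sym2 V → k) :
    concMatrix G x ∈ concentrationSpace k G :=
  ⟨concMatrix_isSymm x, fun i j hij h => concMatrix_apply_of_not x (by tauto)⟩

theorem concMatrix_eq_of_mem {k : Type*} [Field k] {K : Matrix V V k}
    (hK : K ∈ concentrationSpace k G) {x : Sym2 V → k}
    (hx : ∀ i j, (i = j ∨ G.Adj i j) → x s(i, j) = K i j) : concMatrix G x = K := by
  ext i j
  by_cases h : i = j ∨ G.Adj i j
  · rw [concMatrix_apply_of x h, hx i j h]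
  · rw [concMatrix_apply_of_not x h, hK.2 i j (by tauto) (by tauto)]

theorem map_concMatrix {k k' : Type*} [Zero k] [Zero k'] {F : Type*} [FunLike F k k']
    [ZeroHomClass F k k'] (f : F) (x : Sym2 V → k) :
    (concMatrix G x).map f = concMatrix G (f ∘ x) := by
  ext i j
  by_cases h : i = j ∨ G.Adj i j
  · rw [Matrix.map_apply, concMatrix_apply_of x h, concMatrix_apply_of _ h, Function.comp]
  · rw [Matrix.map_apply, concMatrix_apply_of_not x h, concMatrix_apply_of_not _ h, map_zero]

open Classical in
theorem concMatrix_diag_one [DecidableEq V] {k : Type*} [CommRing k] :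
    concMatrix G (fun e => if e.IsDiag then (1 : k) else 0) = 1 := by
  ext i j
  by_cases h : i = j ∨ G.Adj i j
  · simp only [concMatrix_apply_of _ h, Sym2.mk_isDiag_iff, Matrix.one_apply]
  · rw [concMatrix_apply_of_not _ h, Matrix.one_apply, if_neg (by tauto)]

theorem map_det_concMatrix [Fintype V] [DecidableEq V] {k k' : Type*} [CommRing k] [CommRing k']
    (f : k →+* k') (x : Sym2 V → k) : f (concMatrix G x).det = (concMatrix G (f ∘ x)).det := by
  rw [RingHom.map_det, RingHom.mapMatrix_apply, map_concMatrix]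

variable [Fintype V] [DecidableEq V]

theorem inv_isSymm {k : Type*} [CommRing k] {M : Matrix V V k} (hM : M.IsSymm) : M⁻¹.IsSymm := by
  rw [Matrix.IsSymm, Matrix.transpose_nonsing_inv, hM.eq]

variable (G) in
open Classical in
/-- The sufficient statistics of the concentration matrix `concMatrix G x`, namely the entries of
its inverse on the diagonal and on the edges, completed by the coordinates `x` at the non-edges. -/
noncomputable def dataMap {k : Type*} [CommRing k] (x : Sym2 V → k) : Sym2 V → k :=
  Sym2.lift ⟨fun i j => if i = j ∨ G.Adj i j then (concMatrix G x)⁻¹ i j else x s(i, j),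
    fun i j => by
      beta_reduce
      rw [(inv_isSymm (concMatrix_isSymm x)).apply i j, Sym2.eq_swap]
      simp only [eq_or_adj_comm]⟩

theorem dataMap_apply_of {k : Type*} [CommRing k] (x : Sym2 V → k) {i j : V}
    (h : i = j ∨ G.Adj i j) : dataMap G x s(i, j) = (concMatrix G x)⁻¹ i j := if_pos h

theorem dataMap_apply_of_not {k : Type*} [CommRing k] (x : Sym2 V → k) {i j : V}
    (h : ¬ (i = j ∨ G.Adj i j)) : dataMap G x s(i, j) = x s(i, j) := if_neg h

theorem map_inv_of_isUnit_det {k k' : Type*} [CommRing k] [CommRing k'] (f : k →+* k')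
    {M : Matrix V V k} (hM : IsUnit M.det) : M⁻¹.map f = (M.map f)⁻¹ := by
  refine (Matrix.inv_eq_right_inv ?_).symm
  rw [← Matrix.map_mul, Matrix.mul_nonsing_inv M hM, Matrix.map_one f f.map_zero f.map_one]

/-- Invertibility matters: the matrix inverse is zero by convention at a non-unit determinant, which
`f` may send to a unit. -/
theorem map_dataMap {k k' : Type*} [CommRing k] [CommRing k'] (f : k →+* k') {x : Sym2 V → k}
    (hx : IsUnit (concMatrix G x).det) : f ∘ dataMap G x = dataMap G (f ∘ x) := by
  ext e
  induction e using Sym2.ind with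
  | h i j =>
    by_cases h : i = j ∨ G.Adj i j
    · rw [Function.comp, dataMap_apply_of x h, dataMap_apply_of _ h, ← map_concMatrix,
        ← map_inv_of_isUnit_det f hx, Matrix.map_apply]
    · rw [Function.comp, dataMap_apply_of_not x h, dataMap_apply_of_not _ h, Function.comp]

/-- Solutions of the likelihood equations are parametrized by the fibres of `dataMap`. -/
theorem bijOn_likelihoodSolutions (s : Sym2 V → ℂ) :
    Set.BijOn (fun x : Sym2 V → ℂ => (concMatrix G x)⁻¹)
      {x | (concMatrix G x).det ≠ 0 ∧ dataMap G x = s} (likelihoodSolutions G (symMatrix s)) := by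
  refine ⟨fun x hx => ?_, fun x hx y hy hxy => ?_, fun T hT => ?_⟩
  · obtain ⟨hx, rfl⟩ := hx
    refine ⟨inv_isSymm (concMatrix_isSymm x), fun i j hij => ?_, concMatrix G x, concMatrix_mem x,
      Matrix.nonsing_inv_mul _ hx.isUnit⟩
    rw [symMatrix_apply, dataMap_apply_of x hij]
  · have h : concMatrix G x = concMatrix G y := by
      rw [← Matrix.nonsing_inv_nonsing_inv _ hx.1.isUnit,
        ← Matrix.nonsing_inv_nonsing_inv _ hy.1.isUnit]
      exact congrArg (·⁻¹) hxy
    ext e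
    induction e using Sym2.ind with
    | h i j =>
      by_cases hij : i = j ∨ G.Adj i j
      · rw [← concMatrix_apply_of x hij, ← concMatrix_apply_of y hij, h]
      · rw [← dataMap_apply_of_not x hij, ← dataMap_apply_of_not y hij, hx.2, hy.2]
  · classical
    obtain ⟨hTs, hTS, K, hK, hTK⟩ := hT
    let x : Sym2 V → ℂ := Sym2.lift ⟨fun i j => if i = j ∨ G.Adj i j then K i j else s s(i, j),
      fun i j => by
        beta_reduce
        rw [hK.1.apply i j, Sym2.eq_swap]
        simp only [eq_or_adj_comm]⟩
    have hxK : concMatrix G x = K := concMatrix_eq_of_mem hK fun i j h => if_pos h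
    have hdet : IsUnit (concMatrix G x).det := by
      rw [hxK]
      exact IsUnit.of_mul_eq_one T.det (by rw [← Matrix.det_mul, mul_eq_one_comm.1 hTK,
        Matrix.det_one])
    have hinv : (concMatrix G x)⁻¹ = T := by rw [hxK, Matrix.inv_eq_left_inv hTK]
    refine ⟨x, ⟨hdet.ne_zero, ?_⟩, hinv⟩
    ext e
    induction e using Sym2.ind with
    | h i j =>
      by_cases h : i = j ∨ G.Adj i j
      · rw [dataMap_apply_of x h, hinv, hTS i j h, symMatrix_apply]
      · rw [dataMap_apply_of_not x h]
        exact if_neg h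

end Parametrization

/-! ### Coordinate ring of the parameter space -/

section CoordRing

variable {V : Type*} [Fintype V] [DecidableEq V] (k : Type*) [Field k] (G : SimpleGraph V)

/-- The determinant of the generic matrix in `L_G`. -/
noncomputable def concDet : MvPolynomial (Sym2 V) k :=
  (concMatrix G (X : Sym2 V → MvPolynomial (Sym2 V) k)).det

/-- The coordinate ring of the variety of invertible matrices in `L_G`, times the affine space of
non-edge coordinates. -/
abbrev CoordRing : Type _ := Localization.Away (concDet k G)

/-- The generic point. -/
noncomputable def genericPoint (e : Sym2 V) : CoordRing k G :=
  algebraMap (MvPolynomial (Sym2 V) k) _ (X e)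

variable {k G}

theorem eval_concDet (x : Sym2 V → k) : eval x (concDet k G) = (concMatrix G x).det := by
  rw [concDet, map_det_concMatrix]
  congr 2
  ext e
  simp

theorem concDet_ne_zero : concDet k G ≠ 0 := fun h => by
  classical
  have := eval_concDet (G := G) (fun e : Sym2 V => if e.IsDiag then (1 : k) else 0)
  rw [concMatrix_diag_one, Matrix.det_one, h, map_zero] at this
  exact zero_ne_one this

instance : IsDomain (CoordRing k G) :=
  IsLocalization.isDomain_localization (powers_le_nonZeroDivisors_of_noZeroDivisors concDet_ne_zero)

theorem algebraMap_concDet :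
    algebraMap _ (CoordRing k G) (concDet k G) = (concMatrix G (genericPoint k G)).det :=
  map_det_concMatrix (algebraMap (MvPolynomial (Sym2 V) k) (CoordRing k G)) X

theorem isUnit_det_genericPoint : IsUnit (concMatrix G (genericPoint k G)).det := by
  rw [← algebraMap_concDet]
  exact IsLocalization.Away.algebraMap_isUnit _

/-- Evaluation at a point of the variety. -/
noncomputable def evalPoint {x : Sym2 V → k} (hx : (concMatrix G x).det ≠ 0) :
    CoordRing k G →+* k :=
  IsLocalization.Away.lift (concDet k G) (g := eval x) (by rw [eval_concDet]; exact hx.isUnit)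

theorem evalPoint_algebraMap {x : Sym2 V → k} (hx : (concMatrix G x).det ≠ 0)
    (p : MvPolynomial (Sym2 V) k) : evalPoint hx (algebraMap _ _ p) = eval x p :=
  IsLocalization.Away.lift_eq _ _ _

theorem evalPoint_comp_genericPoint {x : Sym2 V → k} (hx : (concMatrix G x).det ≠ 0) :
    evalPoint hx ∘ genericPoint k G = x := by
  ext e
  rw [Function.comp, genericPoint, evalPoint_algebraMap, eval_X]

theorem evalPoint_algebraMap_field {x : Sym2 V → k} (hx : (concMatrix G x).det ≠ 0) (c : k) :
    evalPoint hx (algebraMap k _ c) = c := by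
  rw [IsScalarTower.algebraMap_apply k (MvPolynomial (Sym2 V) k), evalPoint_algebraMap]
  simp

variable (k G) in
/-- The comorphism of `dataMap`. -/
noncomputable def dataComap : MvPolynomial (Sym2 V) k →ₐ[k] CoordRing k G :=
  aeval (dataMap G (genericPoint k G))

/-- Points are plain ring homomorphisms, as in `exists_generic_fiber_encard`, so fixing the
constants is a separate hypothesis. -/
theorem map_dataComap (t : CoordRing k G →+* k) (ht : ∀ c, t (algebraMap k _ c) = c)
    (p : MvPolynomial (Sym2 V) k) :
    t (dataComap k G p) = eval (dataMap G (t ∘ genericPoint k G)) p := by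
  rw [dataComap, aeval_def, hom_eval₂, eval₂_eq_eval_map, ← map_dataMap t isUnit_det_genericPoint]
  have : t.comp (algebraMap k (CoordRing k G)) = RingHom.id k := RingHom.ext ht
  rw [this, map_id]
  rfl

theorem evalPoint_dataComap {x : Sym2 V → k} (hx : (concMatrix G x).det ≠ 0)
    (p : MvPolynomial (Sym2 V) k) :
    evalPoint hx (dataComap k G p) = eval (dataMap G x) p := by
  rw [map_dataComap _ (evalPoint_algebraMap_field hx), evalPoint_comp_genericPoint]

/-- A regular function vanishing on a product of infinite sets vanishes. -/
theorem eq_zero_of_evalPoint_eq_zero {a : CoordRing k G} {S : Sym2 V → Set k}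
    (hS : ∀ e, (S e).Infinite)
    (ha : ∀ x ∈ Set.pi Set.univ S, ∀ hx : (concMatrix G x).det ≠ 0, evalPoint hx a = 0) :
    a = 0 := by
  obtain ⟨n, p, hp⟩ := IsLocalization.Away.surj (concDet k G) a
  -- The extra determinant factor covers the singular points of the product set, where evaluation of
  -- `a` is not available.
  have hpD : p * concDet k G = 0 := funext_set S hS fun x hx => by
    rw [map_mul, map_zero, eval_concDet]
    by_cases h : (concMatrix G x).det = 0
    · rw [h, mul_zero]
    · rw [← evalPoint_algebraMap h, ← hp, map_mul, ha x hx h, zero_mul, zero_mul]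
  rw [(mul_eq_zero.1 hpD).resolve_right concDet_ne_zero, map_zero] at hp
  refine (mul_eq_zero.1 hp).resolve_right (pow_ne_zero _ ?_)
  exact (IsLocalization.Away.algebraMap_isUnit (concDet k G)).ne_zero

/-- Points of the coordinate ring over `s` are the points of the fibre of `dataMap` over `s`. -/
theorem bijOn_ringHom (s : Sym2 V → k) :
    Set.BijOn (fun t : CoordRing k G →+* k => t ∘ genericPoint k G)
      {t | t.comp (dataComap k G : MvPolynomial (Sym2 V) k →+* CoordRing k G) = eval s}
      {x | (concMatrix G x).det ≠ 0 ∧ dataMap G x = s} := by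
  have hC : ∀ t : CoordRing k G →+* k,
      t.comp (dataComap k G : MvPolynomial (Sym2 V) k →+* CoordRing k G) = eval s →
      ∀ c, t (algebraMap k _ c) = c := fun t ht c => by
    have := RingHom.congr_fun ht (C c)
    rw [eval_C] at this
    rwa [RingHom.comp_apply, RingHom.coe_coe, ← algebraMap_eq, AlgHom.commutes] at this
  refine ⟨fun t ht => ⟨?_, ?_⟩, fun t ht t' ht' h => ?_, fun x hx => ?_⟩
  · rw [← map_det_concMatrix]
    exact (isUnit_det_genericPoint.map t).ne_zero
  · ext e
    have := RingHom.congr_fun ht (X e)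
    rwa [RingHom.comp_apply, RingHom.coe_coe, map_dataComap t (hC t ht), eval_X, eval_X] at this
  · apply IsLocalization.ringHom_ext (Submonoid.powers (concDet k G))
    apply MvPolynomial.ringHom_ext
    · intro c
      have hc := (hC t ht c).trans (hC t' ht' c).symm
      rwa [IsScalarTower.algebraMap_apply k (MvPolynomial (Sym2 V) k)] at hc
    · exact fun e => (congrFun h e :)
  · refine ⟨evalPoint hx.1, ?_, evalPoint_comp_genericPoint hx.1⟩
    ext p
    · simp [evalPoint_algebraMap_field]
    · simp [evalPoint_dataComap, hx.2]

end CoordRing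

end GaussianGraphical

/-! ### Openness at positive definite points -/

namespace GaussianGraphical

open MvPolynomial Matrix Filter Topology

open scoped ComplexOrder

section Local

variable {V : Type*} [Fintype V] [DecidableEq V] {G : SimpleGraph V}

variable (G) in
/-- The linear parametrization of `L_G`. -/
noncomputable def concMatrixLinear : (Sym2 V → ℂ) →ₗ[ℂ] Matrix V V ℂ where
  toFun := concMatrix G
  map_add' x y := by
    ext i j
    by_cases h : i = j ∨ G.Adj i j
    · simp only [Matrix.add_apply, concMatrix_apply_of _ h, Pi.add_apply]
    · simp only [Matrix.add_apply, concMatrix_apply_of_not _ h, add_zero]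
  map_smul' c x := by
    ext i j
    by_cases h : i = j ∨ G.Adj i j
    · simp only [Matrix.smul_apply, concMatrix_apply_of _ h, Pi.smul_apply, RingHom.id_apply]
    · simp only [Matrix.smul_apply, concMatrix_apply_of_not _ h, smul_zero]

-- This is `d(K⁻¹) = -K⁻¹ dK K⁻¹`. The norm is auxiliary: it makes matrices a complete normed
-- algebra, where inversion is differentiable at units.
attribute [local instance] Matrix.linftyOpNormedRing Matrix.linftyOpNormedAlgebra in
theorem hasStrictFDerivAt_inv_concMatrix_apply {x : Sym2 V → ℂ} (hx : (concMatrix G x).det ≠ 0)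
    (i j : V) : ∃ L : (Sym2 V → ℂ) →L[ℂ] ℂ,
      HasStrictFDerivAt (fun y => (concMatrix G y)⁻¹ i j) L x ∧
      ∀ h, L h = -((concMatrix G x)⁻¹ * concMatrix G h * (concMatrix G x)⁻¹) i j := by
  have : CompleteSpace (Matrix V V ℂ) := FiniteDimensional.complete ℂ _
  obtain ⟨u, hu⟩ := (Matrix.isUnit_iff_isUnit_det _).2 hx.isUnit
  have huinv : (↑u⁻¹ : Matrix V V ℂ) = (concMatrix G x)⁻¹ := by
    rw [← hu, Matrix.coe_units_inv]
  let P : (Sym2 V → ℂ) →L[ℂ] Matrix V V ℂ := LinearMap.toContinuousLinearMap (concMatrixLinear G)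
  let E : Matrix V V ℂ →L[ℂ] ℂ := LinearMap.toContinuousLinearMap (Matrix.entryLinearMap ℂ ℂ i j)
  have h1 := hasStrictFDerivAt_ringInverse (𝕜 := ℂ) u
  rw [hu] at h1
  have h2 := E.hasStrictFDerivAt.comp x (h1.comp x (P.hasStrictFDerivAt (x := x)))
  refine ⟨_, h2.congr_of_eventuallyEq (Eventually.of_forall fun y => ?_), fun h => ?_⟩
  · exact congrFun (congrFun (Matrix.nonsing_inv_eq_ringInverse (A := concMatrix G y)).symm i) j
  · rw [← huinv]
    rfl

theorem exists_hasStrictFDerivAt_dataMap {x : Sym2 V → ℂ} (hx : (concMatrix G x).det ≠ 0) :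
    ∃ L : (Sym2 V → ℂ) →L[ℂ] (Sym2 V → ℂ), HasStrictFDerivAt (dataMap G) L x ∧
      ∀ h i j, ((i = j ∨ G.Adj i j) → L h s(i, j) =
        -((concMatrix G x)⁻¹ * concMatrix G h * (concMatrix G x)⁻¹) i j) ∧
        (¬ (i = j ∨ G.Adj i j) → L h s(i, j) = h s(i, j)) := by
  have key : ∀ e : Sym2 V, ∃ L : (Sym2 V → ℂ) →L[ℂ] ℂ,
      HasStrictFDerivAt (fun y => dataMap G y e) L x ∧
      ∀ h i j, e = s(i, j) → ((i = j ∨ G.Adj i j) → L h =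
        -((concMatrix G x)⁻¹ * concMatrix G h * (concMatrix G x)⁻¹) i j) ∧
        (¬ (i = j ∨ G.Adj i j) → L h = h s(i, j)) := by
    intro e
    induction e using Sym2.ind with
    | h i j =>
      by_cases hij : i = j ∨ G.Adj i j
      · obtain ⟨L, hL, hL'⟩ := hasStrictFDerivAt_inv_concMatrix_apply hx i j
        refine ⟨L, hL.congr_of_eventuallyEq
          (Eventually.of_forall fun y => (dataMap_apply_of y hij).symm), fun h a b hab => ?_⟩
        rcases Sym2.eq_iff.1 hab with ⟨rfl, rfl⟩ | ⟨rfl, rfl⟩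
        · exact ⟨fun _ => hL' h, fun h => absurd hij h⟩
        · refine ⟨fun _ => ?_, fun h => absurd (eq_or_adj_comm.2 hij) h⟩
          have hsymm : ((concMatrix G x)⁻¹ * concMatrix G h * (concMatrix G x)⁻¹).IsSymm := by
            rw [Matrix.IsSymm, Matrix.transpose_mul, Matrix.transpose_mul,
              (inv_isSymm (concMatrix_isSymm x)).eq, (concMatrix_isSymm h).eq, Matrix.mul_assoc]
          rw [hL' h, hsymm.apply]
      · refine ⟨ContinuousLinearMap.proj s(i, j), HasStrictFDerivAt.congr_of_eventuallyEq
          (ContinuousLinearMap.proj (R := ℂ) (φ := fun _ : Sym2 V => ℂ) s(i, j)).hasStrictFDerivAt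
            (Eventually.of_forall fun y => (dataMap_apply_of_not y hij).symm), fun h a b hab => ?_⟩
        refine ⟨fun hab' => absurd ?_ hij, fun _ => by rw [← hab]; rfl⟩
        rcases Sym2.eq_iff.1 hab with ⟨rfl, rfl⟩ | ⟨rfl, rfl⟩
        exacts [hab', eq_or_adj_comm.2 hab']
  choose L hL hL' using key
  exact ⟨ContinuousLinearMap.pi L, hasStrictFDerivAt_pi'.2 hL, fun h i j => hL' _ h i j rfl⟩

/-- At a matrix in `L_G` whose inverse is positive definite, the sufficient statistics are local
coordinates. -/
theorem map_nhds_dataMap {x : Sym2 V → ℂ} (hx : (concMatrix G x).det ≠ 0) {B : Matrix V V ℂ}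
    (hB : (concMatrix G x)⁻¹ = Bᴴ * B) : map (dataMap G) (𝓝 x) = 𝓝 (dataMap G x) := by
  obtain ⟨L, hL, hL'⟩ := exists_hasStrictFDerivAt_dataMap hx
  refine hL.map_nhds_eq_of_surj
    (LinearMap.range_eq_top.2 (LinearMap.injective_iff_surjective.1
      ((injective_iff_map_eq_zero _).2 fun h hh => ?_)))
  replace hh : L h = 0 := hh
  set T := (concMatrix G x)⁻¹ with hT
  set X := concMatrix G h with hX
  -- For `h` in the kernel, `T * X * T` vanishes on the diagonal and the edges while `X` vanishes
  -- elsewhere, so every summand is zero.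
  have htr : (Xᴴ * (T * X * T)).trace = 0 := by
    refine Finset.sum_eq_zero fun j _ => ?_
    rw [Matrix.diag_apply, Matrix.mul_apply]
    refine Finset.sum_eq_zero fun i _ => ?_
    by_cases hij : i = j ∨ G.Adj i j
    · have := (hL' h i j).1 hij
      rw [hh, Pi.zero_apply, zero_eq_neg] at this
      rw [this, mul_zero]
    · rw [Matrix.conjTranspose_apply, hX, concMatrix_apply_of_not h hij, star_zero, zero_mul]
  -- With `T = Bᴴ * B` the trace above is the squared Frobenius norm of `B * X * Bᴴ`.
  have hBX : B * X * Bᴴ = 0 := by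
    rw [← Matrix.trace_conjTranspose_mul_self_eq_zero_iff, ← htr, hB]
    have : (B * X * Bᴴ)ᴴ * (B * X * Bᴴ) = B * (Xᴴ * (Bᴴ * B) * X * Bᴴ) := by
      simp only [Matrix.conjTranspose_mul, Matrix.conjTranspose_conjTranspose, Matrix.mul_assoc]
    rw [this, Matrix.trace_mul_comm]
    simp only [Matrix.mul_assoc]
  have hBu : IsUnit B.det := by
    have hTu : IsUnit T.det := Matrix.isUnit_nonsing_inv_det _ hx.isUnit
    rw [hB, Matrix.det_mul] at hTu
    exact isUnit_of_mul_isUnit_right hTu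
  have hBu' : IsUnit Bᴴ.det := by
    rw [Matrix.det_conjTranspose]
    exact hBu.star
  have hX0 : X = 0 := by
    have := congrArg (fun M => B⁻¹ * (M * (Bᴴ)⁻¹)) hBX
    simpa [Matrix.mul_nonsing_inv_cancel_right _ _ hBu', Matrix.nonsing_inv_mul_cancel_left _ _ hBu]
      using this
  ext e
  induction e using Sym2.ind with
  | h i j =>
    by_cases hij : i = j ∨ G.Adj i j
    · rw [← concMatrix_apply_of h hij, ← hX, hX0]
      rfl
    · rw [← (hL' h i j).2 hij, hh]

end Local
end GaussianGraphical

/-! ### Dominance and the generic number of solutions -/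

namespace GaussianGraphical

open MvPolynomial Matrix Filter Topology

section GenericCount

/-- A neighbourhood in a finite product contains a product of infinite sets. -/
theorem exists_pi_infinite_subset {ι k : Type*} [Finite ι] [NontriviallyNormedField k]
    {U : Set (ι → k)} {x : ι → k} (hU : U ∈ 𝓝 x) :
    ∃ S : ι → Set k, (∀ i, (S i).Infinite) ∧ Set.pi Set.univ S ⊆ U := by
  rw [nhds_pi, Filter.mem_pi'] at hU
  obtain ⟨I, S, hS, hSU⟩ := hU
  exact ⟨S, fun i => infinite_of_mem_nhds (x i) (hS i),
    (Set.pi_mono' (fun _ _ => subset_rfl) (Set.subset_univ _)).trans hSU⟩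

theorem eq_zero_of_eventually_eval_eq_zero {ι : Type*} [Finite ι] {s : ι → ℂ}
    {p : MvPolynomial ι ℂ}
    (h : ∀ᶠ t in 𝓝 s, eval t p = 0) : p = 0 := by
  obtain ⟨S, hS, hSU⟩ := exists_pi_infinite_subset h
  exact funext_set S hS fun t ht => by
    rw [map_zero]
    exact hSU ht

variable {V : Type*} [Fintype V] [DecidableEq V] {G : SimpleGraph V}

theorem eq_zero_of_eventually_evalPoint_eq_zero {x : Sym2 V → ℂ} {a : CoordRing ℂ G}
    (h : ∀ᶠ y in 𝓝 x, ∀ hy : (concMatrix G y).det ≠ 0, evalPoint hy a = 0) : a = 0 := by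
  obtain ⟨S, hS, hSU⟩ := exists_pi_infinite_subset h
  exact eq_zero_of_evalPoint_eq_zero hS fun y hy hy' => hSU hy hy'

theorem continuous_det_concMatrix :
    Continuous fun x : Sym2 V → ℂ => (concMatrix G x).det := by
  simp_rw [← eval_concDet]
  exact MvPolynomial.continuous_eval _

variable (G) in
/-- The map `dataMap` is dominant. -/
theorem dataComap_injective : Function.Injective (dataComap ℂ G) := by
  classical
  refine (injective_iff_map_eq_zero _).2 fun p hp => ?_
  let x : Sym2 V → ℂ := fun e => if e.IsDiag then 1 else 0
  have hx : concMatrix G x = 1 := concMatrix_diag_one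
  have hdet : (concMatrix G x).det ≠ 0 := by rw [hx, det_one]; exact one_ne_zero
  -- Openness at the identity matrix: a polynomial killed by `dataComap` vanishes on an open set of
  -- data.
  have hmap := map_nhds_dataMap hdet (B := 1) (by simp [hx])
  refine eq_zero_of_eventually_eval_eq_zero (s := dataMap G x) ?_
  rw [← hmap, eventually_map]
  filter_upwards [continuous_det_concMatrix.continuousAt.eventually_ne hdet] with y hy
  rw [← evalPoint_dataComap hy, hp, map_zero]

/-- The map `φ` is explicit because `CoordRing` is already an algebra over the polynomial ring by
localization, which is not the structure given by `dataComap`. -/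
theorem exists_generic_fiber_encard_of_injective {R A : Type*} [CommRing R] [IsDomain R]
    [CharZero R] [IsIntegrallyClosed R] [CommRing A] [IsDomain A] (φ : R →+* A)
    (hφ : Function.Injective φ) (hft : φ.FiniteType)
    (halg : ∀ a, ∃ p : Polynomial R, p ≠ 0 ∧ p.eval₂ φ a = 0)
    (k : Type*) [Field k] [IsAlgClosed k] :
    ∃ (N : ℕ) (f : R), f ≠ 0 ∧ ∀ s : R →+* k, s f ≠ 0 →
      {t : A →+* k | t.comp φ = s}.encard = N := by
  let _ := φ.toAlgebra
  have : FaithfulSMul R A := (faithfulSMul_iff_algebraMap_injective R A).2 hφ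
  have : Algebra.FiniteType R A := hft
  have : Algebra.IsAlgebraic R A := ⟨halg⟩
  exact exists_generic_fiber_encard k

/-- By dominance the data coordinates are algebraically independent, and their number bounds the
transcendence degree; so they form a transcendence basis. -/
theorem exists_ne_zero_eval₂_dataComap (a : CoordRing ℂ G) :
    ∃ p : Polynomial (MvPolynomial (Sym2 V) ℂ), p ≠ 0 ∧
      p.eval₂ (dataComap ℂ G : MvPolynomial (Sym2 V) ℂ →+* CoordRing ℂ G) a = 0 := by
  have hind : AlgebraicIndependent ℂ (dataMap G (genericPoint ℂ G)) := dataComap_injective G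
  have hdeg : Algebra.trdeg ℂ (CoordRing ℂ G) ≤ Cardinal.mk (Sym2 V) := by
    have : FaithfulSMul (MvPolynomial (Sym2 V) ℂ) (CoordRing ℂ G) :=
      (faithfulSMul_iff_algebraMap_injective _ _).2
        (IsLocalization.injective (M := Submonoid.powers (concDet ℂ G)) _
          (powers_le_nonZeroDivisors_of_noZeroDivisors concDet_ne_zero))
    have : Algebra.IsAlgebraic (MvPolynomial (Sym2 V) ℂ) (CoordRing ℂ G) :=
      IsLocalization.isAlgebraic _ (Submonoid.powers (concDet ℂ G))
    rw [← trdeg_add_eq ℂ (MvPolynomial (Sym2 V) ℂ) (A := CoordRing ℂ G),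
      MvPolynomial.trdeg_of_isDomain, trdeg_eq_zero, add_zero]
    simp
  have hb := hind.isTranscendenceBasis_of_trdeg_le_of_finite hdeg
  have := hb.isAlgebraic
  obtain ⟨p, hp, hpa⟩ := Algebra.IsAlgebraic.isAlgebraic
    (R := Algebra.adjoin ℂ (Set.range (dataMap G (genericPoint ℂ G)))) a
  refine ⟨p.map (hind.aevalEquiv.symm : _ →+* _), ?_, ?_⟩
  · rwa [Ne, Polynomial.map_eq_zero_iff]
    exact hind.aevalEquiv.symm.injective
  · rw [Polynomial.eval₂_map, ← hpa, Polynomial.aeval_def]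
    congr 1
    ext q
    obtain ⟨q, rfl⟩ := hind.aevalEquiv.surjective q
    simp [dataComap]

theorem exists_hasGenericSolutionCount (G : SimpleGraph V) :
    ∃ N, HasGenericSolutionCount G N := by
  obtain ⟨N, f, hf, hN⟩ := exists_generic_fiber_encard_of_injective
    (dataComap ℂ G : MvPolynomial (Sym2 V) ℂ →+* CoordRing ℂ G) (dataComap_injective G)
    (by
      have : (dataComap ℂ G).FiniteType := by
        have : Algebra.FiniteType (MvPolynomial (Sym2 V) ℂ) (CoordRing ℂ G) :=
          IsLocalization.finiteType_of_monoid_fg (Submonoid.powers (concDet ℂ G)) _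
        have : Algebra.FiniteType ℂ (CoordRing ℂ G) :=
          .trans (S := MvPolynomial (Sym2 V) ℂ) inferInstance inferInstance
        exact AlgHom.FiniteType.of_comp_finiteType
          (f := Algebra.ofId ℂ (MvPolynomial (Sym2 V) ℂ)) (by
            rw [Subsingleton.elim ((dataComap ℂ G).comp _) (Algebra.ofId ℂ (CoordRing ℂ G))]
            exact RingHom.finiteType_algebraMap.2 this)
      exact this)
    exists_ne_zero_eval₂_dataComap ℂ
  refine ⟨N, f, hf, fun s hs => ?_⟩
  have h1 := bijOn_ringHom (G := G) s
  have h2 := bijOn_likelihoodSolutions (G := G) s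
  rw [← h2.image_eq, h2.injOn.encard_image, ← h1.image_eq, h1.injOn.encard_image]
  exact hN (eval s) hs

end GenericCount

end GaussianGraphical

/-! ### From special data to generic data -/

namespace GaussianGraphical

open MvPolynomial Matrix Filter Topology

section TwoSolutions

variable {V : Type*} [Fintype V] [DecidableEq V] {G : SimpleGraph V}

/-- If some data have two distinct solutions, one of which is positive definite, then there are
generic data with two distinct solutions. -/
theorem exists_generic_two_solutions {x y : Sym2 V → ℂ} (hx : (concMatrix G x).det ≠ 0)
    (hy : (concMatrix G y).det ≠ 0) {B : Matrix V V ℂ} (hB : (concMatrix G x)⁻¹ = Bᴴ * B)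
    (hxy : x ≠ y) (hdata : dataMap G x = dataMap G y) {f : MvPolynomial (Sym2 V) ℂ} (hf : f ≠ 0) :
    ∃ s, eval s f ≠ 0 ∧ ∃ T ∈ likelihoodSolutions G (symMatrix s),
      ∃ T' ∈ likelihoodSolutions G (symMatrix s), T ≠ T' := by
  obtain ⟨U, W, hU, hW, hxU, hyW, hUW⟩ := t2_separation hxy
  have hcont : ContinuousAt (dataMap G) y :=
    (exists_hasStrictFDerivAt_dataMap hy).choose_spec.1.continuousAt
  have hU' : U ∩ {z | (concMatrix G z).det ≠ 0} ∈ 𝓝 x :=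
    inter_mem (hU.mem_nhds hxU) (continuous_det_concMatrix.continuousAt.eventually_ne hx)
  -- Openness is used only at `x`; at `y` continuity is enough, so the second solution need not be
  -- positive definite.
  have himg : dataMap G '' (U ∩ {z | (concMatrix G z).det ≠ 0}) ∈ 𝓝 (dataMap G y) := by
    rw [← hdata, ← map_nhds_dataMap hx hB]
    exact image_mem_map hU'
  have hfreq : ∃ᶠ z in 𝓝 y, ∃ hz : (concMatrix G z).det ≠ 0,
      evalPoint hz (dataComap ℂ G f) ≠ 0 := fun h => by
    refine hf (dataComap_injective G ?_)
    rw [map_zero]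
    refine eq_zero_of_eventually_evalPoint_eq_zero (x := y) ?_
    filter_upwards [h] with z hz hz'
    by_contra hne
    exact hz ⟨hz', hne⟩
  obtain ⟨z, ⟨hz, hfz⟩, hzW, w, ⟨hwU, hw⟩, hwz⟩ :=
    (hfreq.and_eventually ((hW.eventually_mem hyW).and (hcont.eventually_mem himg))).exists
  rw [evalPoint_dataComap] at hfz
  have hb := bijOn_likelihoodSolutions (G := G) (dataMap G z)
  refine ⟨dataMap G z, hfz, _, hb.mapsTo ⟨hz, rfl⟩, _, hb.mapsTo ⟨hw, hwz⟩, fun h => ?_⟩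
  have hzw : z = w := hb.injOn ⟨hz, rfl⟩ ⟨hw, hwz⟩ h
  exact Set.disjoint_left.1 hUW hwU (hzw ▸ hzW)

/-- The same criterion in terms of matrices. -/
theorem exists_generic_two_solutions_of_matrices {K K' T T' B : Matrix V V ℂ}
    (hK : K ∈ concentrationSpace ℂ G) (hK' : K' ∈ concentrationSpace ℂ G) (hTs : T.IsSymm)
    (hTs' : T'.IsSymm) (hTK : T * K = 1) (hTK' : T' * K' = 1) (hB : T = Bᴴ * B)
    (hTT' : ∀ i j, i = j ∨ G.Adj i j → T i j = T' i j) (hne : T ≠ T')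
    {f : MvPolynomial (Sym2 V) ℂ} (hf : f ≠ 0) :
    ∃ s, eval s f ≠ 0 ∧ ∃ T ∈ likelihoodSolutions G (symMatrix s),
      ∃ T' ∈ likelihoodSolutions G (symMatrix s), T ≠ T' := by
  obtain ⟨s, hs⟩ := exists_symMatrix_eq hTs
  have hb := bijOn_likelihoodSolutions (G := G) s
  obtain ⟨x, hx, hxT⟩ := hb.surjOn ⟨hTs, fun i j _ => by rw [hs], K, hK, hTK⟩
  obtain ⟨y, hy, hyT⟩ := hb.surjOn
    (show T' ∈ likelihoodSolutions G (symMatrix s) from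
      ⟨hTs', fun i j h => by rw [hs, hTT' i j h], K', hK', hTK'⟩)
  refine exists_generic_two_solutions hx.1 hy.1 (B := B) (hxT.trans hB) ?_
    (hx.2.trans hy.2.symm) hf
  rintro rfl
  exact hne (hxT.symm.trans hyT)

theorem one_lt_mlDegree (h : ∀ f : MvPolynomial (Sym2 V) ℂ, f ≠ 0 →
    ∃ s, eval s f ≠ 0 ∧ ∃ T ∈ likelihoodSolutions G (symMatrix s),
      ∃ T' ∈ likelihoodSolutions G (symMatrix s), T ≠ T') : 1 < mlDegree G := by
  have hex := exists_hasGenericSolutionCount G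
  rw [mlDegree, dif_pos hex]
  obtain ⟨f, hf, hN⟩ := hex.choose_spec
  obtain ⟨s, hs, T, hT, T', hT', hne⟩ := h f hf
  have : 1 < (likelihoodSolutions G (symMatrix s)).encard :=
    Set.one_lt_encard_iff.2 ⟨T, T', hT, hT', hne⟩
  rw [hN s hs] at this
  exact_mod_cast this

end TwoSolutions

end GaussianGraphical

/-! ### Two solutions for special data on cycles -/

namespace GaussianGraphical

open MvPolynomial Matrix

section FourCycle

/-- Give opposite edges the values `0` and `b`, and both non-edges the value `x`. Such matrices are
diagonalized by the characters of the Klein four-group, and the inverse vanishes at the non-edges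
when `x = 0` or `x² = 1 + b²`. The choice `b = 3/4` makes `x = 5/4` rational. -/
theorem exists_generic_two_solutions_cycleGraph_four {f : MvPolynomial (Sym2 (Fin 4)) ℂ}
    (hf : f ≠ 0) :
    ∃ s, eval s f ≠ 0 ∧ ∃ T ∈ likelihoodSolutions (SimpleGraph.cycleGraph 4) (symMatrix s),
      ∃ T' ∈ likelihoodSolutions (SimpleGraph.cycleGraph 4) (symMatrix s), T ≠ T' := by
  -- The number `7 / 16 = 1 - (3/4)²` is the pivot in the Cholesky factor `B` of `T`.
  obtain ⟨r, hr, hr'⟩ : ∃ r : ℂ, r * r = 7 / 16 ∧ (starRingEnd ℂ) r = r := by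
    refine ⟨((√7 / 4 : ℝ) : ℂ), ?_, Complex.conj_ofReal _⟩
    rw [← Complex.ofReal_mul, div_mul_div_comm, Real.mul_self_sqrt (by norm_num)]
    push_cast
    norm_num
  have h3 : (starRingEnd ℂ) 3 = 3 := map_ofNat _ 3
  have h4 : (starRingEnd ℂ) 4 = 4 := map_ofNat _ 4
  have hadj : ∀ i j : Fin 4, i ≠ j → ¬ (SimpleGraph.cycleGraph 4).Adj i j →
      (i = 0 ∧ j = 2) ∨ (i = 2 ∧ j = 0) ∨ (i = 1 ∧ j = 3) ∨ (i = 3 ∧ j = 1) := by decide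
  have hadj' : ∀ i j : Fin 4, i = j ∨ (SimpleGraph.cycleGraph 4).Adj i j →
      ¬ ((i = 0 ∧ j = 2) ∨ (i = 2 ∧ j = 0) ∨ (i = 1 ∧ j = 3) ∨ (i = 3 ∧ j = 1)) := by decide
  let T : Matrix (Fin 4) (Fin 4) ℂ := !![1, 0, 0, 3/4; 0, 1, 3/4, 0; 0, 3/4, 1, 0; 3/4, 0, 0, 1]
  let K : Matrix (Fin 4) (Fin 4) ℂ := !![16/7, 0, 0, -12/7; 0, 16/7, -12/7, 0;
    0, -12/7, 16/7, 0; -12/7, 0, 0, 16/7]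
  let T' : Matrix (Fin 4) (Fin 4) ℂ := !![1, 0, 5/4, 3/4; 0, 1, 3/4, 5/4; 5/4, 3/4, 1, 0;
    3/4, 5/4, 0, 1]
  let K' : Matrix (Fin 4) (Fin 4) ℂ := !![1/2, -5/6, 0, 2/3; -5/6, 1/2, 2/3, 0;
    0, 2/3, 1/2, -5/6; 2/3, 0, -5/6, 1/2]
  let B : Matrix (Fin 4) (Fin 4) ℂ := !![1, 0, 0, 3/4; 0, 1, 3/4, 0; 0, 0, r, 0; 0, 0, 0, r]
  refine exists_generic_two_solutions_of_matrices (K := K) (K' := K') (T := T) (T' := T') (B := B)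
    ⟨?_, ?_⟩ ⟨?_, ?_⟩ ?_ ?_ ?_ ?_ ?_ ?_ ?_ hf
  · exact IsSymm.ext fun i j => by fin_cases i <;> fin_cases j <;> simp [K]
  · intro i j hij h
    rcases hadj i j hij h with ⟨rfl, rfl⟩ | ⟨rfl, rfl⟩ | ⟨rfl, rfl⟩ | ⟨rfl, rfl⟩ <;> simp [K]
  · exact IsSymm.ext fun i j => by fin_cases i <;> fin_cases j <;> simp [K']
  · intro i j hij h
    rcases hadj i j hij h with ⟨rfl, rfl⟩ | ⟨rfl, rfl⟩ | ⟨rfl, rfl⟩ | ⟨rfl, rfl⟩ <;> simp [K']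
  · exact IsSymm.ext fun i j => by fin_cases i <;> fin_cases j <;> simp [T]
  · exact IsSymm.ext fun i j => by fin_cases i <;> fin_cases j <;> simp [T']
  · ext i j
    fin_cases i <;> fin_cases j <;> simp [T, K, Matrix.mul_apply, Fin.sum_univ_four] <;> norm_num
  · ext i j
    fin_cases i <;> fin_cases j <;> simp [T', K', Matrix.mul_apply, Fin.sum_univ_four] <;> norm_num
  · ext i j
    fin_cases i <;> fin_cases j <;>
      simp [T, B, Matrix.mul_apply, Fin.sum_univ_four, hr', hr, h3, h4] <;> norm_num
  · intro i j h
    have := hadj' i j h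
    fin_cases i <;> fin_cases j <;> first | (exfalso; simp at this; done) | simp [T, T']
  · intro h
    have := congrFun (congrFun h 0) 2
    change (0 : ℂ) = 5 / 4 at this
    norm_num at this

end FourCycle

section LongCycle

/-- The first column of the circulant solution for identity data on the cycle with `n + 1`
vertices. -/
noncomputable def circulantCov (n : ℕ) (i : Fin (n + 1)) : ℝ :=
  -Real.sin ((i.val - 1) * (Real.pi / (n - 1))) / Real.sin (Real.pi / (n - 1))

variable {n : ℕ}

theorem sin_pi_div_pos (hn : 4 ≤ n) : 0 < Real.sin (Real.pi / (n - 1)) := by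
  have h : (4 : ℝ) ≤ n := by exact_mod_cast hn
  apply Real.sin_pos_of_pos_of_lt_pi (div_pos Real.pi_pos (by linarith))
  rw [div_lt_iff₀ (by linarith)]
  nlinarith [Real.pi_pos]

/-- At `n = 3` this cosine is zero and the circulant inverse does not exist, so the four-cycle is
treated separately. -/
theorem cos_pi_div_pos (hn : 4 ≤ n) : 0 < Real.cos (Real.pi / (n - 1)) := by
  have h : (4 : ℝ) ≤ n := by exact_mod_cast hn
  have h0 : 0 < Real.pi / ((n : ℝ) - 1) := div_pos Real.pi_pos (by linarith)
  apply Real.cos_pos_of_mem_Ioo ⟨by linarith [Real.pi_pos], ?_⟩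
  rw [div_lt_div_iff₀ (by linarith) (by norm_num)]
  nlinarith [Real.pi_pos]

theorem mul_pi_div (hn : 4 ≤ n) : ((n : ℝ) - 1) * (Real.pi / (n - 1)) = Real.pi := by
  have h : (4 : ℝ) ≤ n := by exact_mod_cast hn
  exact mul_div_cancel₀ _ (by linarith)

theorem circulantCov_zero (hn : 4 ≤ n) : circulantCov n 0 = 1 := by
  rw [circulantCov]
  simp [Real.sin_neg, (sin_pi_div_pos hn).ne']

theorem circulantCov_one (hn : 4 ≤ n) : circulantCov n 1 = 0 := by
  have : ((1 : Fin (n + 1)) : ℕ) = 1 := by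
    rw [Fin.val_one']; exact Nat.mod_eq_of_lt (by omega)
  rw [circulantCov, this]
  simp

theorem circulantCov_two (hn : 4 ≤ n) : circulantCov n 2 = -1 := by
  have : ((2 : Fin (n + 1)) : ℕ) = 2 := by
    rw [Fin.coe_ofNat_eq_mod]; exact Nat.mod_eq_of_lt (by omega)
  rw [circulantCov, this]
  have := (sin_pi_div_pos hn).ne'
  push_cast
  rw [show ((2 : ℝ) - 1) = 1 by norm_num, one_mul, neg_div, div_self this]

/-- The angle `π / (n - 1)` is chosen for this: replacing `i` by `n + 1 - i` turns the argument of
the sine into `π` minus itself. -/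
theorem circulantCov_neg (hn : 4 ≤ n) (i : Fin (n + 1)) :
    circulantCov n (-i) = circulantCov n i := by
  by_cases hi : i = 0
  · rw [hi, neg_zero]
  have hval : ((-i : Fin (n + 1)) : ℕ) = n + 1 - i.val := by
    rw [Fin.val_neg, if_neg hi]
  rw [circulantCov, circulantCov, hval, Nat.cast_sub i.2.le]
  congr 2
  rw [show (((n + 1 : ℕ) : ℝ) - (i.val : ℝ) - 1) * (Real.pi / (n - 1)) =
    (n - 1) * (Real.pi / (n - 1)) - (i.val - 1) * (Real.pi / (n - 1)) by push_cast; ring,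
    mul_pi_div hn, Real.sin_pi_sub]

/-- Away from `0` this is the sine addition formula; at `0` both neighbours vanish and leave the
`1`. Thus a circulant supported on the diagonal and the edges inverts the circulant of `circulantCov
n`. -/
theorem circulantCov_recurrence (hn : 4 ≤ n) (i : Fin (n + 1)) :
    circulantCov n i - (2 * Real.cos (Real.pi / (n - 1)))⁻¹ *
      (circulantCov n (i - 1) + circulantCov n (i + 1)) = if i = 0 then 1 else 0 := by
  split_ifs with hi
  · rw [hi, zero_sub, zero_add, circulantCov_neg hn, circulantCov_one hn, circulantCov_zero hn]
    simp
  have hadd : circulantCov n (i + 1) =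
      -Real.sin (((i.val + 1) - 1) * (Real.pi / (n - 1))) / Real.sin (Real.pi / (n - 1)) := by
    -- At the wrap-around the sine formula at `n + 1` must agree with the entry at `0`; both equal
    -- `1`.
    by_cases hl : i = Fin.last n
    · rw [hl, Fin.last_add_one, circulantCov_zero hn, Fin.val_last,
        show ((n : ℝ) + 1 - 1) * (Real.pi / (n - 1)) =
          (n - 1) * (Real.pi / (n - 1)) + Real.pi / (n - 1) by ring, mul_pi_div hn, add_comm,
          Real.sin_add_pi, neg_neg, div_self (sin_pi_div_pos hn).ne']
    · rw [circulantCov, Fin.val_add_one, if_neg hl]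
      push_cast
      rfl
  have hsub : circulantCov n (i - 1) =
      -Real.sin (((i.val - 1) - 1) * (Real.pi / (n - 1))) / Real.sin (Real.pi / (n - 1)) := by
    have h1 : 1 ≤ i.val := Nat.one_le_iff_ne_zero.2 (mt Fin.val_eq_zero_iff.1 hi)
    rw [circulantCov, Fin.coe_sub_one, if_neg hi, Nat.cast_sub h1, Nat.cast_one]
  rw [hadd, hsub, circulantCov]
  have hc := (cos_pi_div_pos hn).ne'
  have hs := (sin_pi_div_pos hn).ne'
  set α := Real.pi / ((n : ℝ) - 1)
  rw [show ((i.val : ℝ) + 1 - 1) * α = (i.val - 1) * α + α by ring,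
    show ((i.val : ℝ) - 1 - 1) * α = (i.val - 1) * α - α by ring, Real.sin_add, Real.sin_sub]
  field_simp
  ring

theorem exists_generic_two_solutions_cycleGraph_succ (hn : 4 ≤ n)
    {f : MvPolynomial (Sym2 (Fin (n + 1))) ℂ} (hf : f ≠ 0) :
    ∃ s, eval s f ≠ 0 ∧ ∃ T ∈ likelihoodSolutions (SimpleGraph.cycleGraph (n + 1)) (symMatrix s),
      ∃ T' ∈ likelihoodSolutions (SimpleGraph.cycleGraph (n + 1)) (symMatrix s), T ≠ T' := by
  let v : Fin (n + 1) → ℂ := fun i => (circulantCov n i : ℂ)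
  let b : ℂ := -(((2 * Real.cos (Real.pi / (n - 1)))⁻¹ : ℝ) : ℂ)
  let w : Fin (n + 1) → ℂ := Pi.single 0 1 + b • (Pi.single 1 1 + Pi.single (-1) 1)
  have hv : ∀ i, v (-i) = v i := fun i => congrArg Complex.ofReal (circulantCov_neg hn i)
  have hw : ∀ i, w (-i) = w i := fun i => by
    simp only [w, Pi.add_apply, Pi.smul_apply, Pi.single_apply, neg_eq_iff_eq_neg, neg_zero,
      neg_neg]
    rw [add_comm (if i = -1 then (1 : ℂ) else 0)]
  have hadj : ∀ i j, (SimpleGraph.cycleGraph (n + 1)).Adj i j ↔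
      i ≠ j ∧ (i - j = 1 ∨ i - j = -1) := by
    intro i j
    rw [SimpleGraph.cycleGraph_eq_circulantGraph, SimpleGraph.circulantGraph_adj]
    simp only [Set.mem_singleton_iff]
    rw [← neg_sub i j, neg_eq_iff_eq_neg]
  have hcirc : ∀ u : Fin (n + 1) → ℂ, (∀ i, u (-i) = u i) → (circulant u).IsSymm := fun u hu => by
    ext i j
    rw [transpose_apply, circulant_apply, circulant_apply, ← neg_sub, hu]
  refine exists_generic_two_solutions_of_matrices (K := 1) (K' := circulant w) (T := 1)
    (T' := circulant v) (B := 1) ⟨isSymm_one, fun i j hij _ => one_apply_ne hij⟩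
    ⟨hcirc w hw, ?_⟩ isSymm_one (hcirc v hv) (one_mul 1) ?_ (by simp) ?_ ?_ hf
  · intro i j hij h
    rw [hadj] at h
    have h0 : i - j ≠ 0 := sub_ne_zero.2 hij
    simp only [circulant_apply, w, Pi.add_apply, Pi.smul_apply, Pi.single_apply]
    rw [if_neg h0, if_neg (by tauto), if_neg (by tauto)]
    simp
  · rw [circulant_mul, ← circulant_single_one]
    congr 1
    ext i
    simp only [w, mulVec_add, mulVec_smul, mulVec_single, Pi.add_apply, Pi.smul_apply]
    have := congrArg (fun z : ℝ => (z : ℂ)) (circulantCov_recurrence hn i)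
    simp only [Pi.single_apply, circulant_apply, col_apply, v, b] at this ⊢
    simp only [MulOpposite.op_one, one_smul, sub_zero, sub_neg_eq_add, smul_eq_mul]
    rw [apply_ite Complex.ofReal, Complex.ofReal_one, Complex.ofReal_zero] at this
    rw [← this]
    push_cast
    ring
  · intro i j hij
    rw [circulant_apply]
    rcases hij with rfl | hij
    · rw [sub_self, one_apply_eq]
      simp [v, circulantCov_zero hn]
    · rw [hadj] at hij
      rw [one_apply_ne hij.1]
      rcases hij.2 with h | h
      · rw [h]
        simp [v, circulantCov_one hn]
      · rw [h, hv]
        simp [v, circulantCov_one hn]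
  · intro h
    have h20 : (2 : Fin (n + 1)) ≠ 0 := by
      intro h
      have := congrArg Fin.val h
      rw [Fin.coe_ofNat_eq_mod, Nat.mod_eq_of_lt (by omega)] at this
      simp at this
    -- The pair `2, 0` is a non-edge, where the circulant solution is `-1` and the identity is `0`.
    have := congrFun (congrFun h 2) 0
    rw [one_apply_ne h20, circulant_apply, sub_zero] at this
    simp [v, circulantCov_two hn] at this

end LongCycle

theorem exists_generic_two_solutions_cycleGraph {m : ℕ} (hm : 4 ≤ m)
    {f : MvPolynomial (Sym2 (Fin m)) ℂ} (hf : f ≠ 0) :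
    ∃ s, eval s f ≠ 0 ∧ ∃ T ∈ likelihoodSolutions (SimpleGraph.cycleGraph m) (symMatrix s),
      ∃ T' ∈ likelihoodSolutions (SimpleGraph.cycleGraph m) (symMatrix s), T ≠ T' := by
  obtain rfl | hm' := hm.eq_or_lt
  · exact exists_generic_two_solutions_cycleGraph_four hf
  · obtain ⟨n, rfl⟩ : ∃ n, m = n + 1 := ⟨m - 1, by omega⟩
    exact exists_generic_two_solutions_cycleGraph_succ (by omega) hf

end GaussianGraphical

/-! ### Irrationality of the maximum likelihood estimate -/

namespace GaussianGraphical

open MvPolynomial Matrix Filter Topology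

section MLE

variable {V : Type*} {G : SimpleGraph V}

theorem continuous_concMatrix : Continuous (concMatrix G : (Sym2 V → ℝ) → Matrix V V ℝ) := by
  refine continuous_matrix fun i j => ?_
  by_cases h : i = j ∨ G.Adj i j
  · simp only [concMatrix_apply_of _ h]
    exact continuous_apply _
  · simp only [concMatrix_apply_of_not _ h]
    exact continuous_const

theorem symMatrix_isSymm {k : Type*} (s : Sym2 V → k) : (symMatrix s).IsSymm :=
  IsSymm.ext fun i j => by rw [symMatrix_apply, symMatrix_apply, Sym2.eq_swap]

variable [Fintype V] [DecidableEq V]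

/-- Sum `log t ≤ t - 1` over the eigenvalues. -/
theorem log_det_le_trace_sub_card {M : Matrix V V ℝ} (hM : M.PosDef) :
    Real.log M.det ≤ M.trace - Fintype.card V := by
  have hdet := hM.isHermitian.det_eq_prod_eigenvalues
  have htr := hM.isHermitian.trace_eq_sum_eigenvalues
  simp only [RCLike.ofReal_real_eq_id, id_eq] at hdet htr
  rw [hdet, htr, Real.log_prod (fun i _ => (hM.eigenvalues_pos i).ne'), ← Finset.card_univ,
    ← nsmul_one, ← Finset.sum_const, ← Finset.sum_sub_distrib]
  exact Finset.sum_le_sum fun i _ => Real.log_le_sub_one_of_pos (hM.eigenvalues_pos i)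

open scoped MatrixOrder in
-- Write `T = Bᴴ * B` and apply the previous bound to `B * K * Bᴴ`. For `T` the inverse of a
-- candidate, this is its optimality.
theorem log_det_add_log_det_le {T K : Matrix V V ℝ} (hT : T.PosDef) (hK : K.PosDef) :
    Real.log T.det + Real.log K.det ≤ (T * K).trace - Fintype.card V := by
  obtain ⟨B, rfl⟩ := CStarAlgebra.nonneg_iff_eq_star_mul_self.mp hT.posSemidef.nonneg
  rw [star_eq_conjTranspose] at hT ⊢
  have hB : IsUnit B :=
    (isUnit_iff_isUnit_det _).2 (isUnit_of_mul_isUnit_right (det_mul Bᴴ B ▸ hT.det_pos.ne'.isUnit))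
  have hN := hK.mul_mul_conjTranspose_same (vecMul_injective_of_isUnit hB)
  have h := log_det_le_trace_sub_card hN
  rw [← Real.log_mul hT.det_pos.ne' hK.det_pos.ne', Matrix.mul_assoc Bᴴ,
    trace_mul_comm Bᴴ]
  convert h using 2
  simp only [det_mul]
  ring

/-- A positive definite matrix in `L_G` is the maximum likelihood estimate of the concentration
matrix for all data which agree with its inverse on the diagonal and on the edges. -/
theorem isMLE_inv {K S : Matrix V V ℝ} (hK : K ∈ concentrationSpace ℝ G) (hpos : K.PosDef)
    (hS : ∀ i j, i = j ∨ G.Adj i j → S i j = K⁻¹ i j) : IsMLE G S K⁻¹ := by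
  have hdet : IsUnit K.det := hpos.det_pos.ne'.isUnit
  have htr : ∀ L ∈ concentrationSpace ℝ G, (S * L).trace = (K⁻¹ * L).trace := fun L hL => by
    refine Finset.sum_congr rfl fun i _ => ?_
    simp only [diag_apply, mul_apply]
    refine Finset.sum_congr rfl fun j _ => ?_
    by_cases h : i = j ∨ G.Adj i j
    · rw [hS i j h]
    · rw [hL.1.apply i j, hL.2 i j (by tauto) (by tauto), mul_zero, mul_zero]
  rw [IsMLE, nonsing_inv_nonsing_inv _ hdet]
  refine ⟨hpos.inv, hK, fun L hL hLpos => ?_⟩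
  rw [logLikelihood, logLikelihood, htr L hL, htr K hK, nonsing_inv_mul _ hdet, trace_one]
  have h := log_det_add_log_det_le hpos.inv hLpos
  rw [det_nonsing_inv, Ring.inverse_eq_inv', Real.log_inv] at h
  linarith

/-- By Cauchy–Schwarz the perturbation changes the quadratic form by at most `card V * ε` times `∑ x
i ^ 2`. -/
theorem posDef_of_abs_sub_one_le {M : Matrix V V ℝ} (hM : M.IsSymm) {ε : ℝ}
    (hε : Fintype.card V * ε < 1) (h : ∀ i j, |M i j - (1 : Matrix V V ℝ) i j| ≤ ε) :
    M.PosDef := by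
  refine .of_dotProduct_mulVec_pos
    (by rw [IsHermitian, conjTranspose_eq_transpose_of_trivial, hM.eq]) fun x hx => ?_
  have hsq : 0 < ∑ i, x i ^ 2 := by
    obtain ⟨i, hi⟩ := Function.ne_iff.1 hx
    exact Finset.sum_pos' (fun i _ => sq_nonneg _) ⟨i, Finset.mem_univ i, sq_pos_of_ne_zero hi⟩
  have h1 : star x ⬝ᵥ (M *ᵥ x) = ∑ i, x i ^ 2 +
      ∑ i, ∑ j, x i * (M i j - (1 : Matrix V V ℝ) i j) * x j := by
    have : star x ⬝ᵥ (M *ᵥ x) = x ⬝ᵥ ((1 : Matrix V V ℝ) *ᵥ x) + x ⬝ᵥ ((M - 1) *ᵥ x) := by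
      rw [← dotProduct_add, ← add_mulVec, add_sub_cancel, star_trivial]
    rw [this, one_mulVec]
    simp only [dotProduct, mulVec, Matrix.sub_apply, Finset.mul_sum, mul_assoc, sq]
  have h2 : -(ε * (∑ i, |x i|) ^ 2) ≤
      ∑ i, ∑ j, x i * (M i j - (1 : Matrix V V ℝ) i j) * x j := by
    rw [sq, Finset.sum_mul_sum, Finset.mul_sum, ← Finset.sum_neg_distrib]
    refine Finset.sum_le_sum fun i _ => ?_
    rw [Finset.mul_sum, ← Finset.sum_neg_distrib]
    refine Finset.sum_le_sum fun j _ => neg_le_of_abs_le ?_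
    rw [abs_mul, abs_mul, mul_comm |x i|, mul_assoc]
    exact mul_le_mul_of_nonneg_right (h i j) (by positivity)
  have h3 : (∑ i, |x i|) ^ 2 ≤ Fintype.card V * ∑ i, x i ^ 2 := by
    simpa using sq_sum_le_card_mul_sum_sq (s := Finset.univ) (f := fun i => |x i|)
  have hε0 : 0 ≤ ε := by
    obtain ⟨i, hi⟩ := Function.ne_iff.1 hx
    exact (abs_nonneg _).trans (h i i)
  rw [h1]
  nlinarith [mul_le_mul_of_nonneg_left h3 hε0]

theorem eventually_posDef {X : Type*} [TopologicalSpace X] {x : X} {M : X → Matrix V V ℝ}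
    (hM : ∀ y, (M y).IsSymm) (hcont : ContinuousAt M x) (hx : M x = 1) :
    ∀ᶠ y in 𝓝 x, (M y).PosDef := by
  obtain ⟨ε, hε, hε'⟩ : ∃ ε : ℝ, 0 < ε ∧ Fintype.card V * ε < 1 := by
    refine ⟨(Fintype.card V + 1 : ℝ)⁻¹, by positivity, ?_⟩
    rw [← div_eq_mul_inv, div_lt_one (by positivity)]
    linarith
  have : ∀ᶠ y in 𝓝 x, ∀ i j, |M y i j - (1 : Matrix V V ℝ) i j| < ε := by
    rw [eventually_all]
    intro i
    rw [eventually_all]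
    intro j
    have hij : ContinuousAt (fun y => |M y i j - (1 : Matrix V V ℝ) i j|) x :=
      (((continuousAt_pi.1 (continuousAt_pi.1 hcont i)) j).sub continuousAt_const).abs
    refine hij.eventually_lt continuousAt_const ?_
    rw [hx]
    simpa using hε
  filter_upwards [this] with y hy
  exact posDef_of_abs_sub_one_le (hM y) hε' fun i j => (hy i j).le

theorem continuousAt_dataMap_real {y : Sym2 V → ℝ} (hy : (concMatrix G y).det ≠ 0) :
    ContinuousAt (dataMap G) y := by
  have hinv : ContinuousAt (fun z => (concMatrix G z)⁻¹) y := by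
    simp only [inv_def, Ring.inverse_eq_inv']
    exact (continuous_concMatrix.matrix_det.continuousAt.inv₀ hy).smul
      continuous_concMatrix.matrix_adjugate.continuousAt
  refine continuousAt_pi.2 fun e => ?_
  induction e using Sym2.ind with
  | h i j =>
    by_cases h : i = j ∨ G.Adj i j
    · simp only [dataMap_apply_of _ h]
      exact continuousAt_pi.1 (continuousAt_pi.1 hinv i) j
    · simp only [dataMap_apply_of_not _ h]
      exact (continuous_apply _).continuousAt

/-- Near the identity, `dataMap` takes values in positive definite data whose maximum likelihood
estimate is the inverse of the parameter. -/
theorem exists_eventually_isMLE : ∃ y : Sym2 V → ℝ, ∀ᶠ z in 𝓝 y,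
    (symMatrix (dataMap G z)).PosDef ∧ IsMLE G (symMatrix (dataMap G z)) (concMatrix G z)⁻¹ := by
  classical
  -- The non-edge coordinates are zero as well, so that the whole data matrix, and not only the
  -- concentration matrix, is the identity.
  let y : Sym2 V → ℝ := fun e => if e.IsDiag then 1 else 0
  have hy : concMatrix G y = 1 := concMatrix_diag_one
  have hdata : symMatrix (dataMap G y) = 1 := by
    ext i j
    rw [symMatrix_apply]
    by_cases h : i = j ∨ G.Adj i j
    · rw [dataMap_apply_of _ h, hy, inv_one]
    · rw [dataMap_apply_of_not _ h, one_apply_ne (by tauto)]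
      exact if_neg (by rw [Sym2.mk_isDiag_iff]; tauto)
  have hcont : ContinuousAt (fun z => symMatrix (dataMap G z)) y := by
    have := continuousAt_dataMap_real (G := G) (y := y) (by rw [hy, det_one]; exact one_ne_zero)
    exact continuousAt_pi.2 fun i => continuousAt_pi.2 fun j => continuousAt_pi.1 this s(i, j)
  refine ⟨y, ?_⟩
  filter_upwards [eventually_posDef (fun z => concMatrix_isSymm z)
    continuous_concMatrix.continuousAt hy, eventually_posDef (fun z => symMatrix_isSymm _) hcont
    hdata] with z hz hz'
  exact ⟨hz', isMLE_inv (concMatrix_mem z) hz fun i j h => by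
    rw [symMatrix_apply, dataMap_apply_of _ h]⟩

/-- A rational formula for the maximum likelihood estimate holds for all complex solutions of the
likelihood equations. -/
theorem apply_eq_div_of_isMLE_eq_div {i j : V} {p q : MvPolynomial (Sym2 V) ℝ}
    (hpq : ∀ (s : Sym2 V → ℝ) (T : Matrix V V ℝ), (symMatrix s).PosDef → IsMLE G (symMatrix s) T →
      eval s q ≠ 0 → T i j = eval s p / eval s q)
    {s : Sym2 V → ℂ} {T : Matrix V V ℂ} (hT : T ∈ likelihoodSolutions G (symMatrix s))
    (hs : eval s (map Complex.ofRealHom q) ≠ 0) :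
    T i j = eval s (map Complex.ofRealHom p) / eval s (map Complex.ofRealHom q) := by
  let Q := dataComap ℂ G (map Complex.ofRealHom q)
  let P := dataComap ℂ G (map Complex.ofRealHom p)
  have heval : ∀ {x : Sym2 V → ℂ} (hx : (concMatrix G x).det ≠ 0),
      evalPoint hx (Q * ((concMatrix G (genericPoint ℂ G))⁻¹ i j * Q - P)) =
        eval (dataMap G x) (map Complex.ofRealHom q) *
          ((concMatrix G x)⁻¹ i j * eval (dataMap G x) (map Complex.ofRealHom q) -
            eval (dataMap G x) (map Complex.ofRealHom p)) := fun {x} hx => by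
    have : evalPoint hx ((concMatrix G (genericPoint ℂ G))⁻¹ i j) = (concMatrix G x)⁻¹ i j := by
      rw [← Matrix.map_apply (f := evalPoint hx), map_inv_of_isUnit_det _ isUnit_det_genericPoint,
        map_concMatrix, evalPoint_comp_genericPoint]
    rw [map_mul, map_sub, map_mul, this, evalPoint_dataComap, evalPoint_dataComap]
  -- A box of real parameters is Zariski dense in the complex ones. The outer factor `Q` takes care
  -- of points where the denominator vanishes.
  have hzero : Q * ((concMatrix G (genericPoint ℂ G))⁻¹ i j * Q - P) = 0 := by
    obtain ⟨y, hy⟩ := exists_eventually_isMLE (G := G)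
    obtain ⟨S, hS, hSy⟩ := exists_pi_infinite_subset hy
    refine eq_zero_of_evalPoint_eq_zero (S := fun e => Complex.ofRealHom '' S e)
      (fun e => (hS e).image Complex.ofReal_injective.injOn) fun x hx hdet => ?_
    choose z hz hzx using fun e => hx e (Set.mem_univ e)
    obtain rfl : Complex.ofRealHom ∘ z = x := funext hzx
    obtain ⟨hpos, hmle⟩ := hSy (show z ∈ Set.pi Set.univ S from fun e _ => hz e)
    have hdet' : IsUnit (concMatrix G z).det := by
      rw [← map_det_concMatrix] at hdet
      exact isUnit_iff_ne_zero.2 fun h => hdet (by rw [h, map_zero])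
    rw [heval hdet, ← map_concMatrix, ← map_inv_of_isUnit_det _ hdet', ← map_dataMap _ hdet',
      Matrix.map_apply]
    have hmap : ∀ r : MvPolynomial (Sym2 V) ℝ,
        eval (Complex.ofRealHom ∘ dataMap G z) (map Complex.ofRealHom r) =
          Complex.ofRealHom (eval (dataMap G z) r) := fun r => by
      rw [eval_map, ← eval₂_comp]
    rw [hmap, hmap, ← map_mul, ← map_sub, ← map_mul, map_eq_zero]
    by_cases hq : eval (dataMap G z) q = 0
    · rw [hq, zero_mul]
    · rw [hpq _ _ hpos hmle hq, div_mul_cancel₀ _ hq, sub_self, mul_zero]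
  obtain ⟨x, ⟨hx, rfl⟩, rfl⟩ := (bijOn_likelihoodSolutions s).surjOn hT
  have h := heval hx
  rw [hzero, map_zero, eq_comm, mul_eq_zero] at h
  rw [eq_div_iff hs]
  exact sub_eq_zero.1 (h.resolve_left hs)

/-- The product of all denominators serves as the genericity condition; off its zeros one formula
computes both solutions. -/
theorem not_mleIsRational (h : ∀ f : MvPolynomial (Sym2 V) ℂ, f ≠ 0 →
    ∃ s, eval s f ≠ 0 ∧ ∃ T ∈ likelihoodSolutions G (symMatrix s),
      ∃ T' ∈ likelihoodSolutions G (symMatrix s), T ≠ T') : ¬ MLEIsRational G := by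
  intro hrat
  choose p q hq hpq using hrat
  obtain ⟨s, hs, T, hT, T', hT', hne⟩ := h (∏ i, ∏ j, map Complex.ofRealHom (q i j)) (by
    refine Finset.prod_ne_zero_iff.2 fun i _ => Finset.prod_ne_zero_iff.2 fun j _ => ?_
    exact (map_ne_zero_iff _ (map_injective _ Complex.ofReal_injective)).2 (hq i j))
  simp only [map_prod, Finset.prod_ne_zero_iff] at hs
  refine hne (Matrix.ext fun i j => ?_)
  have hsij := hs i (Finset.mem_univ i) j (Finset.mem_univ j)
  rw [apply_eq_div_of_isMLE_eq_div (hpq i j) hT hsij,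
    apply_eq_div_of_isMLE_eq_div (hpq i j) hT' hsij]

end MLE

end GaussianGraphical

theorem lemma4p6 (m : ℕ) (hm : 4 ≤ m) :
    1 < GaussianGraphical.mlDegree (SimpleGraph.cycleGraph m) ∧
      ¬ GaussianGraphical.MLEIsRational (SimpleGraph.cycleGraph m) :=
  ⟨GaussianGraphical.one_lt_mlDegree fun _ hf =>
      GaussianGraphical.exists_generic_two_solutions_cycleGraph hm hf,
    GaussianGraphical.not_mleIsRational fun _ hf =>
      GaussianGraphical.exists_generic_two_solutions_cycleGraph hm hf⟩
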